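/- Let $\mathbb D$ be the open unit disc in $\mathbb C$. By a weight we mean a strictly positive, radial, continuous function $v:\mathbb D\to(0,\infty)$ with $\lim_{|z|\to1^-}v(z)=0$. Put $$H_v^\infty=\{f:\mathbb D\to\mathbb C \text{ holomorphic}: \|f\|_{H_v^\infty}=\sup_{z\in\mathbb D}|f(z)|v(z)<\infty\},\qquad H_v^0=\{f:\mathbb D\to\mathbb C\text{ holomorphic}: \lim_{|z|\to1^-}|f(z)|v(z)=0\},$$ where $H_v^0\subset H_v^\infty$ carries the norm of $H_v^\infty$. Let $\tilde v(z)=1/\sup\{|f(z)|:\|f\|_{H_v^\infty}\le1\}$; the weight $v$ is called essential if there are constants $c,C>0$ with $c\,v\le\tilde v\le C\,v$ on $\mathbb D$. Let $v$ and $w$ be essential weights, let $\varphi:\mathbb D\to\mathbb D$ be analytic, and let $C_\varphi f=f\circ\varphi$. Then the following are equivalent (in (i), (ii), (i$'$), (ii$'$) it is part of the condition that $C_\varphi$ is a well-defined bounded operator between the indicated spaces; weakly compact means that the image of the closed unit ball is relatively weakly compact): (i) $C_\varphi:H_v^\infty\to H_w^\infty$ is compact; (ii) $C_\varphi:H_v^0\to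 H_w^0$ is compact; (iii) $\displaystyle\lim_{r\to1^-}\sup_{|\varphi(z)|>r}\frac{w(z)}{v(\varphi(z))}=0$ or $\overline{\varphi(\mathbb D)}\subset\mathbb D$; (iv) $\displaystyle\lim_{|z|\to1^-}\frac{w(z)}{v(\varphi(z))}=0$; (i$'$) $C_\varphi:H_v^\infty\to H_w^\infty$ is weakly compact; (ii$'$) $C_\varphi:H_v^0\to H_w^0$ is weakly compact; (iii$'$) $C_\varphi(H_v^\infty)\subset H_w^0$. -/

import Mathlib

open Filter Topology Complex
open scoped Complex.UnitDisc

noncomputable section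

namespace WeightedHol

/-- Holomorphy of a function on the open unit disc: it is the restriction of a function that is
complex differentiable on the open unit ball of `ℂ`. -/
def IsHolomorphic (f : 𝔻 → ℂ) : Prop :=
  ∃ F : ℂ → ℂ, DifferentiableOn ℂ F (Metric.ball 0 1) ∧ ∀ z : 𝔻, F z = f z

/-- The filter on the disc expressing `|z| → 1⁻`. -/
def toBoundary : Filter 𝔻 := comap (fun z : 𝔻 => ‖(z : ℂ)‖) (𝓝[<] 1)

/-- A strictly positive, radial, continuous weight on the disc that vanishes at the boundary. -/
structure Weight where
  toFun : 𝔻 → ℝ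
  pos : ∀ z, 0 < toFun z
  radial : ∀ z z' : 𝔻, ‖(z : ℂ)‖ = ‖(z' : ℂ)‖ → toFun z = toFun z'
  continuous : Continuous toFun
  vanishes : Tendsto toFun toBoundary (𝓝 0)

instance : CoeFun Weight (fun _ => 𝔻 → ℝ) := ⟨Weight.toFun⟩

/-- `f` is holomorphic and `sup |f| v < ∞`. -/
def MemHInf (v : Weight) (f : 𝔻 → ℂ) : Prop :=
  IsHolomorphic f ∧ BddAbove (Set.range fun z => ‖f z‖ * v z)

/-- `f` is holomorphic and `|f(z)| v(z) → 0` as `|z| → 1⁻`. -/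
def MemHZero (v : Weight) (f : 𝔻 → ℂ) : Prop :=
  IsHolomorphic f ∧ Tendsto (fun z => ‖f z‖ * v z) toBoundary (𝓝 0)

theorem IsHolomorphic.zero : IsHolomorphic 0 :=
  ⟨0, differentiableOn_const 0, fun _ => rfl⟩

theorem IsHolomorphic.add {f g : 𝔻 → ℂ} (hf : IsHolomorphic f) (hg : IsHolomorphic g) :
    IsHolomorphic (f + g) := by
  obtain ⟨F, hF, hFf⟩ := hf
  obtain ⟨G, hG, hGg⟩ := hg
  exact ⟨F + G, hF.add hG, fun z => by simp [hFf, hGg]⟩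

theorem IsHolomorphic.smul {f : 𝔻 → ℂ} (c : ℂ) (hf : IsHolomorphic f) :
    IsHolomorphic (c • f) := by
  obtain ⟨F, hF, hFf⟩ := hf
  exact ⟨c • F, hF.const_smul c, fun z => by simp [hFf]⟩

/-- `H_v^∞` as a linear subspace of all functions on the disc. -/
def hInfSubmodule (v : Weight) : Submodule ℂ (𝔻 → ℂ) where
  carrier := {f | MemHInf v f}
  zero_mem' := ⟨IsHolomorphic.zero, 0, by rintro _ ⟨z, rfl⟩; simp⟩
  add_mem' := by
    rintro f g ⟨hf, A, hA⟩ ⟨hg, B, hB⟩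
    refine ⟨hf.add hg, A + B, ?_⟩
    rintro _ ⟨z, rfl⟩
    have h1 : ‖f z‖ * v z ≤ A := hA ⟨z, rfl⟩
    have h2 : ‖g z‖ * v z ≤ B := hB ⟨z, rfl⟩
    have h3 := mul_le_mul_of_nonneg_right (norm_add_le (f z) (g z)) (v.pos z).le
    simp only [Pi.add_apply]
    linarith
  smul_mem' := by
    rintro c f ⟨hf, A, hA⟩
    refine ⟨hf.smul c, ‖c‖ * A, ?_⟩
    rintro _ ⟨z, rfl⟩
    have h1 : ‖f z‖ * v z ≤ A := hA ⟨z, rfl⟩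
    simp only [Pi.smul_apply, smul_eq_mul, norm_mul, mul_assoc]
    gcongr

/-- The space `H_v^∞`. It is a type of its own, so that its topology is the one of the weighted
sup norm below and not the topology of pointwise convergence. -/
def HInf (v : Weight) : Type := hInfSubmodule v

namespace HInf

variable {v : Weight}

instance : AddCommGroup (HInf v) := inferInstanceAs (AddCommGroup (hInfSubmodule v))

instance : Module ℂ (HInf v) := inferInstanceAs (Module ℂ (hInfSubmodule v))

instance : CoeFun (HInf v) (fun _ => 𝔻 → ℂ) := ⟨fun f => f.1⟩

/-- The weighted sup norm `‖f‖ = sup_z |f(z)| v(z)`. -/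
instance : Norm (HInf v) := ⟨fun f => ⨆ z, ‖f z‖ * v z⟩

theorem norm_def (f : HInf v) : ‖f‖ = ⨆ z, ‖f z‖ * v z := rfl

theorem memHInf (f : HInf v) : MemHInf v f := f.2

@[ext]
theorem ext {f g : HInf v} (h : ∀ z, f z = g z) : f = g := Subtype.ext (funext h)

@[simp]
theorem zero_apply (z : 𝔻) : (0 : HInf v) z = 0 := rfl

@[simp]
theorem add_apply (f g : HInf v) (z : 𝔻) : (f + g) z = f z + g z := rfl

@[simp]
theorem smul_apply (c : ℂ) (f : HInf v) (z : 𝔻) : (c • f) z = c * f z := rfl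

theorem le_norm (f : HInf v) (z : 𝔻) : ‖f z‖ * v z ≤ ‖f‖ := le_ciSup f.2.2 z

theorem norm_le {f : HInf v} {A : ℝ} (h : ∀ z, ‖f z‖ * v z ≤ A) : ‖f‖ ≤ A :=
  ciSup_le h

theorem core (v : Weight) : NormedSpace.Core ℂ (HInf v) where
  norm_nonneg f := Real.iSup_nonneg fun z => mul_nonneg (norm_nonneg _) (v.pos z).le
  norm_smul c f := by
    simp only [norm_def, smul_apply, norm_mul, mul_assoc]
    exact (Real.mul_iSup_of_nonneg (norm_nonneg c) _).symm
  norm_triangle f g := norm_le fun z => by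
    have h1 := le_norm f z
    have h2 := le_norm g z
    have h3 := mul_le_mul_of_nonneg_right (norm_add_le (f z) (g z)) (v.pos z).le
    rw [add_apply]
    linarith
  norm_eq_zero_iff f := by
    constructor
    · intro h
      ext z
      have h1 := le_norm f z
      rw [h] at h1
      have h2 : ‖f z‖ ≤ 0 := nonpos_of_mul_nonpos_left h1 (v.pos z)
      simpa using h2
    · rintro rfl
      simp [norm_def]

instance : NormedAddCommGroup (HInf v) := NormedAddCommGroup.ofCore (core v)

instance : NormedSpace ℂ (HInf v) := NormedSpace.ofCore (core v)

end HInf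

/-- The space `H_v^0`, with the norm inherited from `H_v^∞`. -/
def HZero (v : Weight) : Submodule ℂ (HInf v) where
  carrier := {f | MemHZero v f}
  zero_mem' := ⟨IsHolomorphic.zero, by simpa using tendsto_const_nhds⟩
  add_mem' := by
    rintro f g ⟨hf, hf0⟩ ⟨hg, hg0⟩
    refine ⟨hf.add hg, squeeze_zero (fun z => mul_nonneg (norm_nonneg _) (v.pos z).le)
      (fun z => ?_) (by simpa using hf0.add hg0)⟩
    have h3 := mul_le_mul_of_nonneg_right (norm_add_le (f z) (g z)) (v.pos z).le
    rw [HInf.add_apply]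
    linarith
  smul_mem' := by
    rintro c f ⟨hf, hf0⟩
    refine ⟨hf.smul c, ?_⟩
    simpa [mul_assoc] using hf0.const_mul ‖c‖

/-- The associated weight `ṽ(z) = 1 / sup {|f(z)| : ‖f‖_{H_v^∞} ≤ 1}`. -/
def assocWeight (v : Weight) (z : 𝔻) : ℝ :=
  1 / ⨆ f : {f : HInf v // ‖f‖ ≤ 1}, ‖f.1 z‖

/-- A weight is essential if it is comparable to its associated weight. -/
def Weight.IsEssential (v : Weight) : Prop :=
  ∃ c C : ℝ, 0 < c ∧ 0 < C ∧ ∀ z, c * v z ≤ assocWeight v z ∧ assocWeight v z ≤ C * v z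

/-- A bounded operator is weakly compact if the image of the closed unit ball is relatively
compact in the weak topology. -/
def IsWeaklyCompactOperator {E F : Type*} [NormedAddCommGroup E] [NormedSpace ℂ E]
    [NormedAddCommGroup F] [NormedSpace ℂ F] (T : E →L[ℂ] F) : Prop :=
  IsCompact (closure ((fun x => toWeakSpace ℂ F (T x)) '' Metric.closedBall (0 : E) 1))

/-- `T` is the composition operator `C_φ : H_v^∞ → H_w^∞`. -/
def IsCompInf {v w : Weight} (φ : 𝔻 → 𝔻) (T : HInf v →L[ℂ] HInf w) : Prop :=
  ∀ (f : HInf v) (z : 𝔻), T f z = f (φ z)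

/-- `T` is the composition operator `C_φ : H_v^0 → H_w^0`. -/
def IsCompZero {v w : Weight} (φ : 𝔻 → 𝔻) (T : HZero v →L[ℂ] HZero w) : Prop :=
  ∀ (f : HZero v) (z : 𝔻), (T f : HInf w) z = (f : HInf v) (φ z)

end WeightedHol

end

noncomputable section

namespace WeightedHol

theorem eventually_toBoundary {p : 𝔻 → Prop} :
    (∀ᶠ z in toBoundary, p z) ↔ ∃ r < 1, ∀ z : 𝔻, r < ‖(z : ℂ)‖ → p z := by
  have h : toBoundary.HasBasis (fun r : ℝ => r < 1)
      (fun r => (fun z : 𝔻 => ‖(z : ℂ)‖) ⁻¹' Set.Ioo r 1) := (nhdsLT_basis (1 : ℝ)).comap _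
  rw [h.eventually_iff]
  refine exists_congr fun r => and_congr_right fun _ => ?_
  exact ⟨fun H z hz => H ⟨hz, z.norm_lt_one⟩, fun H z hz => H z hz.1⟩

theorem isCompact_norm_le {r : ℝ} (hr : r < 1) : IsCompact {z : 𝔻 | ‖(z : ℂ)‖ ≤ r} := by
  rw [UnitDisc.isEmbedding_coe.isCompact_iff]
  convert isCompact_closedBall (0 : ℂ) r using 1
  ext z
  simp only [Set.mem_image, Set.mem_ofPred_eq, mem_closedBall_zero_iff]
  exact ⟨by rintro ⟨x, hx, rfl⟩; exact hx, fun h => ⟨.mk z (h.trans_lt hr), h, rfl⟩⟩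

theorem Weight.exists_lower_bound (v : Weight) {r : ℝ} (hr : r < 1) :
    ∃ m > 0, ∀ z : 𝔻, ‖(z : ℂ)‖ ≤ r → m ≤ v z := by
  rcases Set.eq_empty_or_nonempty {z : 𝔻 | ‖(z : ℂ)‖ ≤ r} with h | h
  · exact ⟨1, one_pos, fun z hz => absurd (show z ∈ {z : 𝔻 | ‖(z : ℂ)‖ ≤ r} from hz) (by simp [h])⟩
  · obtain ⟨x, -, hx⟩ := (isCompact_norm_le hr).exists_isMinOn h v.continuous.continuousOn
    exact ⟨v x, v.pos x, fun z hz => hx hz⟩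

theorem exists_upper_bound {g : 𝔻 → ℝ} (hg : Continuous g) {r : ℝ} (hr : r < 1) :
    ∃ M > 0, ∀ z : 𝔻, ‖(z : ℂ)‖ ≤ r → g z ≤ M := by
  obtain ⟨M, hM⟩ := (isCompact_norm_le hr).bddAbove_image hg.continuousOn
  exact ⟨max M 1, by positivity, fun z hz => (hM ⟨z, hz, rfl⟩).trans (le_max_left _ _)⟩

theorem IsHolomorphic.continuous {f : 𝔻 → ℂ} (hf : IsHolomorphic f) : Continuous f := by
  obtain ⟨F, hF, hFf⟩ := hf
  have h := hF.continuousOn.comp_continuous UnitDisc.continuous_coe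
    (fun z => by simpa using z.norm_lt_one)
  exact h.congr hFf

theorem IsHolomorphic.continuous_map {φ : 𝔻 → 𝔻} (hφ : IsHolomorphic fun z => (φ z : ℂ)) :
    Continuous φ :=
  UnitDisc.isEmbedding_coe.continuous_iff.2 hφ.continuous

theorem IsHolomorphic.comp {f : 𝔻 → ℂ} {φ : 𝔻 → 𝔻} (hf : IsHolomorphic f)
    (hφ : IsHolomorphic fun z => (φ z : ℂ)) : IsHolomorphic (f ∘ φ) := by
  obtain ⟨F, hF, hFf⟩ := hf
  obtain ⟨Φ, hΦ, hΦφ⟩ := hφ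
  refine ⟨F ∘ Φ, hF.comp hΦ fun z hz => ?_, fun z => by simp [hΦφ, hFf]⟩
  have h := hΦφ (.mk z (by simpa using hz))
  rw [UnitDisc.coe_mk] at h
  rw [h]
  simpa using (φ _).norm_lt_one

theorem IsHolomorphic.mul {f g : 𝔻 → ℂ} (hf : IsHolomorphic f) (hg : IsHolomorphic g) :
    IsHolomorphic (f * g) := by
  obtain ⟨F, hF, hFf⟩ := hf
  obtain ⟨G, hG, hGg⟩ := hg
  exact ⟨F * G, hF.mul hG, fun z => by simp [hFf, hGg]⟩

theorem tendsto_iSup_iff_tendsto_toBoundary (v w : Weight) {φ : 𝔻 → 𝔻} (hφ : Continuous φ) :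
    Tendsto (fun r : ℝ => ⨆ (z : 𝔻) (_ : r < ‖(φ z : ℂ)‖), ENNReal.ofReal (w z / v (φ z)))
      (𝓝[<] 1) (𝓝 0) ↔ Tendsto (fun z => w z / v (φ z)) toBoundary (𝓝 0) := by
  have hnn : ∀ z, 0 ≤ w z / v (φ z) := fun z => (div_pos (w.pos _) (v.pos _)).le
  constructor
  · intro h
    rw [Metric.tendsto_nhds]
    intro ε hε
    have h1 := (ENNReal.tendsto_nhds_zero.1 h (ENNReal.ofReal (ε / 2)) (by simpa using hε))
    obtain ⟨r, hr, hr1⟩ := (h1.and self_mem_nhdsWithin).exists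
    have hr1 : r < 1 := hr1
    obtain ⟨m, hm, hmv⟩ := v.exists_lower_bound hr1
    have hw := w.vanishes.eventually (gt_mem_nhds (mul_pos hε hm))
    filter_upwards [hw] with z hz
    rw [Real.dist_eq, sub_zero, abs_of_nonneg (hnn z)]
    by_cases hzr : r < ‖(φ z : ℂ)‖
    · have h2 := (le_iSup₂ (f := fun (z : 𝔻) (_ : r < ‖(φ z : ℂ)‖) =>
        ENNReal.ofReal (w z / v (φ z))) z hzr).trans hr
      rw [ENNReal.ofReal_le_ofReal_iff (by positivity)] at h2
      linarith
    · rw [div_lt_iff₀ (v.pos _)]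
      exact hz.trans_le (by gcongr; exact hmv _ (not_lt.1 hzr))
  · intro h
    rw [ENNReal.tendsto_nhds_zero]
    intro ε hε
    obtain ⟨δ, -, hδ0, hδε⟩ := ENNReal.lt_iff_exists_real_btwn.1 hε
    have hδ : 0 < δ := by simpa using hδ0
    obtain ⟨R, hR, hRz⟩ := eventually_toBoundary.1 (h.eventually (gt_mem_nhds hδ))
    obtain ⟨ρ, hρ, hρz⟩ : ∃ ρ < 1, ∀ z : 𝔻, ‖(z : ℂ)‖ ≤ R → ‖(φ z : ℂ)‖ ≤ ρ := by
      rcases Set.eq_empty_or_nonempty {z : 𝔻 | ‖(z : ℂ)‖ ≤ R} with h | h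
      · exact ⟨0, one_pos, fun z hz =>
          absurd (show z ∈ {z : 𝔻 | ‖(z : ℂ)‖ ≤ R} from hz) (by simp [h])⟩
      · obtain ⟨x, -, hx⟩ := (isCompact_norm_le hR).exists_isMaxOn h
          (UnitDisc.continuous_coe.comp hφ).norm.continuousOn
        exact ⟨_, (φ x).norm_lt_one, fun z hz => hx hz⟩
    filter_upwards [Ioo_mem_nhdsLT hρ] with r hr
    refine iSup₂_le fun z hz => le_trans (ENNReal.ofReal_le_ofReal ?_) hδε.le
    refine (hRz z ?_).le
    by_contra! hzR
    exact absurd (hρz z hzR) (not_le.2 (hr.1.trans hz))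

theorem tendsto_iSup_of_closure_subset (v w : Weight) {φ : 𝔻 → 𝔻}
    (h : closure (Set.range fun z => (φ z : ℂ)) ⊆ Metric.ball 0 1) :
    Tendsto (fun r : ℝ => ⨆ (z : 𝔻) (_ : r < ‖(φ z : ℂ)‖), ENNReal.ofReal (w z / v (φ z)))
      (𝓝[<] 1) (𝓝 0) := by
  have hc : IsCompact (closure (Set.range fun z => (φ z : ℂ))) :=
    Metric.isCompact_of_isClosed_isBounded isClosed_closure (Metric.isBounded_ball.subset h)
  obtain ⟨x, hx, hmax⟩ := hc.exists_isMaxOn ⟨_, subset_closure ⟨0, rfl⟩⟩ continuous_norm.continuousOn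
  have hx1 : ‖x‖ < 1 := by simpa using h hx
  refine tendsto_const_nhds.congr' ?_
  filter_upwards [Ioo_mem_nhdsLT hx1] with r hr
  symm
  simp only [ENNReal.iSup_eq_zero]
  intro z hz
  exact absurd (hmax (subset_closure ⟨z, rfl⟩) : ‖(φ z : ℂ)‖ ≤ ‖x‖) (not_le.2 (hr.1.trans hz))

/-- A family of holomorphic functions bounded by `K / v` is equicontinuous. -/
theorem exists_equicontinuity_nhds (v : Weight) (K : ℝ) (x : 𝔻) {ε : ℝ} (hε : 0 < ε) :
    ∃ U ∈ 𝓝 x, ∀ f : 𝔻 → ℂ, IsHolomorphic f → (∀ z, ‖f z‖ * v z ≤ K) →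
      ∀ y ∈ U, ‖f y - f x‖ ≤ ε := by
  set δ := (1 - ‖(x : ℂ)‖) / 2 with hδ
  have hx := x.norm_lt_one
  have hδ0 : 0 < δ := by linarith
  obtain ⟨m, hm, hmv⟩ := v.exists_lower_bound (r := ‖(x : ℂ)‖ + δ) (by linarith)
  set A := 2 * (|K| / m) + 1
  have hA : 0 < A := by positivity
  refine ⟨UnitDisc.coe ⁻¹' Metric.ball (x : ℂ) (min δ (ε * δ / A)),
    UnitDisc.continuous_coe.continuousAt.preimage_mem_nhds (Metric.ball_mem_nhds _ (by positivity)),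
    fun f hf hfK y hy => ?_⟩
  obtain ⟨F, hF, hFf⟩ := hf
  have hb : ∀ z ∈ Metric.ball (x : ℂ) δ, ‖z‖ < ‖(x : ℂ)‖ + δ := fun z hz => by
    have h1 := norm_sub_norm_le z (x : ℂ)
    rw [mem_ball_iff_norm] at hz
    linarith
  have hfb : ∀ z : 𝔻, ‖(z : ℂ)‖ ≤ ‖(x : ℂ)‖ + δ → ‖f z‖ ≤ |K| / m := fun z hz => by
    rw [le_div_iff₀ hm]
    calc ‖f z‖ * m ≤ ‖f z‖ * v z := by gcongr; exact hmv z hz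
      _ ≤ |K| := (hfK z).trans (le_abs_self K)
  have hmaps : Set.MapsTo F (Metric.ball (x : ℂ) δ) (Metric.ball (F x) A) := fun z hz => by
    have h1 := hb z hz
    lift z to 𝔻 using by linarith
    rw [mem_ball_iff_norm, hFf, hFf]
    have := norm_sub_le (f z) (f x)
    have := hfb z h1.le
    have := hfb x (by linarith)
    linarith
  have hsub : Metric.ball (x : ℂ) δ ⊆ Metric.ball 0 1 := fun z hz => by
    have := hb z hz
    simp only [mem_ball_zero_iff]
    linarith
  rw [Set.mem_preimage, Metric.mem_ball, lt_min_iff] at hy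
  have h := dist_le_div_mul_dist_of_mapsTo_ball (hF.mono hsub)
    (hmaps.mono_right Metric.ball_subset_closedBall) hy.1
  rw [hFf, hFf, dist_eq_norm] at h
  refine h.trans ?_
  calc A / δ * dist (y : ℂ) x ≤ A / δ * (ε * δ / A) := by gcongr; exact hy.2.le
    _ = ε := by field_simp

/-- Pointwise limits of locally bounded families of holomorphic functions are locally
uniform. -/
theorem tendstoLocallyUniformly_of_tendsto {ι : Type*} {l : Filter ι} [l.NeBot] {v : Weight} {K : ℝ}
    {F : ι → 𝔻 → ℂ} {f : 𝔻 → ℂ} (hF : ∀ i, IsHolomorphic (F i))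
    (hK : ∀ i z, ‖F i z‖ * v z ≤ K) (hlim : ∀ z, Tendsto (fun i => F i z) l (𝓝 (f z))) :
    TendstoLocallyUniformly F f l := by
  rw [Metric.tendstoLocallyUniformly_iff]
  intro ε hε x
  obtain ⟨U, hU, hUf⟩ := exists_equicontinuity_nhds v K x (show 0 < ε / 4 by linarith)
  refine ⟨U, hU, ?_⟩
  filter_upwards [Metric.tendsto_nhds.1 (hlim x) (ε / 4) (by linarith)] with i hi y hy
  have h1 : ‖f y - f x‖ ≤ ε / 4 := le_of_tendsto (((hlim y).sub (hlim x)).norm)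
    (.of_forall fun j => hUf (F j) (hF j) (hK j) y hy)
  have h2 := hUf (F i) (hF i) (hK i) y hy
  rw [← dist_eq_norm] at h1 h2
  calc dist (f y) (F i y) ≤ dist (f y) (f x) + dist (f x) (F i x) + dist (F i x) (F i y) :=
        dist_triangle4 _ _ _ _
    _ < ε := by rw [dist_comm (f x), dist_comm (F i x) (F i y)]; linarith

theorem IsHolomorphic.of_tendstoLocallyUniformly {ι : Type*} {l : Filter ι} [l.NeBot]
    {F : ι → 𝔻 → ℂ} {f : 𝔻 → ℂ} (hF : ∀ i, IsHolomorphic (F i))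
    (h : TendstoLocallyUniformly F f l) : IsHolomorphic f := by
  classical
  choose G hG hGF using hF
  let g : ℂ → ℂ := fun z => if hz : ‖z‖ < 1 then f (.mk z hz) else 0
  have hg : ∀ z : 𝔻, g z = f z := fun z => by simp [g, z.norm_lt_one]
  refine ⟨g, ?_, hg⟩
  have hlim : TendstoLocallyUniformlyOn G g l (Metric.ball 0 1) := by
    rw [Metric.tendstoLocallyUniformlyOn_iff]
    rw [Metric.tendstoLocallyUniformly_iff] at h
    intro ε hε x hx
    lift x to 𝔻 using by simpa using hx
    obtain ⟨t, ht, hlt⟩ := h ε hε x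
    refine ⟨UnitDisc.coe '' t, ?_, ?_⟩
    · rw [UnitDisc.isEmbedding_coe.nhds_eq_comap] at ht
      obtain ⟨s, hs, hst⟩ := ht
      refine mem_nhdsWithin_iff_exists_mem_nhds_inter.2 ⟨s, hs, ?_⟩
      rintro y ⟨hy, hy1⟩
      lift y to 𝔻 using by simpa using hy1
      exact ⟨y, hst hy, rfl⟩
    · filter_upwards [hlt] with i hi
      rintro _ ⟨y, hy, rfl⟩
      rw [hg, hGF]
      exact hi y hy
  exact hlim.differentiableOn (.of_forall hG) Metric.isOpen_ball

theorem HInf.isHolomorphic {v : Weight} (f : HInf v) : IsHolomorphic f := f.2.1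

@[simp]
theorem HInf.sub_apply {v : Weight} (f g : HInf v) (z : 𝔻) : (f - g) z = f z - g z := rfl

theorem HInf.norm_apply_le {v : Weight} (f : HInf v) (z : 𝔻) : ‖f z‖ ≤ ‖f‖ / v z :=
  (le_div_iff₀ (v.pos z)).2 (f.le_norm z)

/-- Point evaluation as a bounded functional. -/
def HInf.evalCLM {v : Weight} (z : 𝔻) : HInf v →L[ℂ] ℂ :=
  LinearMap.mkContinuous
    { toFun := fun f => f z
      map_add' := fun _ _ => rfl
      map_smul' := fun _ _ => rfl } (1 / v z) fun f =>
    (f.norm_apply_le z).trans_eq (by ring)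

theorem mem_HZero {v : Weight} (f : HInf v) :
    f ∈ HZero v ↔ Tendsto (fun z => ‖f z‖ * v z) toBoundary (𝓝 0) :=
  ⟨fun h => h.2, fun h => ⟨f.2.1, h⟩⟩

theorem isClosed_HZero (v : Weight) : IsClosed (HZero v : Set (HInf v)) := by
  refine isClosed_of_closure_subset fun f hf => ?_
  rw [SetLike.mem_coe, mem_HZero, Metric.tendsto_nhds]
  intro ε hε
  obtain ⟨g, hg, hfg⟩ := Metric.mem_closure_iff.1 hf (ε / 2) (by linarith)
  rw [SetLike.mem_coe, mem_HZero, Metric.tendsto_nhds] at hg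
  filter_upwards [hg (ε / 2) (by linarith)] with z hz
  have hnn : ∀ h : HInf v, 0 ≤ ‖h z‖ * v z := fun h => mul_nonneg (norm_nonneg _) (v.pos z).le
  rw [Real.dist_eq, sub_zero, abs_of_nonneg (hnn _)] at hz ⊢
  have h1 := (f - g).le_norm z
  rw [← dist_eq_norm, HInf.sub_apply] at h1
  have h2 : ‖f z‖ * v z ≤ (‖f z - g z‖ + ‖g z‖) * v z :=
    mul_le_mul_of_nonneg_right (by simpa using norm_add_le (f z - g z) (g z)) (v.pos z).le
  linarith

theorem memHZero_of_bounded {w : Weight} {f : 𝔻 → ℂ} (hf : IsHolomorphic f) {M : ℝ}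
    (hM : ∀ z, ‖f z‖ ≤ M) : MemHZero w f := by
  refine ⟨hf, squeeze_zero (fun z => mul_nonneg (norm_nonneg _) (w.pos z).le)
    (fun z => mul_le_mul_of_nonneg_right (hM z) (w.pos z).le) ?_⟩
  simpa using w.vanishes.const_mul M

theorem bounded_of_tendsto_toBoundary {g : 𝔻 → ℝ} (hg : Continuous g)
    (h : Tendsto g toBoundary (𝓝 0)) : ∃ B > 0, ∀ z, g z ≤ B := by
  obtain ⟨R, hR, hRz⟩ := eventually_toBoundary.1 (h.eventually (gt_mem_nhds one_pos))
  obtain ⟨M, hM, hMz⟩ := exists_upper_bound hg hR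
  refine ⟨max M 1, by positivity, fun z => ?_⟩
  rcases le_or_gt ‖(z : ℂ)‖ R with hz | hz
  · exact (hMz z hz).trans (le_max_left _ _)
  · exact (hRz z hz).le.trans (le_max_right _ _)

theorem norm_comp_mul_le {v : Weight} (w : Weight) (φ : 𝔻 → 𝔻) (f : HInf v) (z : 𝔻) :
    ‖f (φ z)‖ * w z ≤ ‖f‖ * (w z / v (φ z)) := by
  have h := mul_le_mul_of_nonneg_right (f.norm_apply_le (φ z)) (w.pos z).le
  rwa [div_mul_eq_mul_div, mul_div_assoc] at h

/-- The composition operator on `H_v^∞`, bounded when `w / (v ∘ φ)` is. -/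
def compCLM {v w : Weight} (φ : 𝔻 → 𝔻) (hφ : IsHolomorphic fun z => (φ z : ℂ)) (B : ℝ)
    (hB : ∀ z, w z / v (φ z) ≤ B) : HInf v →L[ℂ] HInf w :=
  have key : ∀ (f : HInf v) z, ‖f (φ z)‖ * w z ≤ B * ‖f‖ := fun f z =>
    (norm_comp_mul_le w φ f z).trans (by
      rw [mul_comm B]
      exact mul_le_mul_of_nonneg_left (hB z) (norm_nonneg f))
  LinearMap.mkContinuous
    { toFun := fun f => ⟨fun z => f (φ z), f.isHolomorphic.comp hφ, B * ‖f‖, by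
        rintro _ ⟨z, rfl⟩; exact key f z⟩
      map_add' := fun _ _ => rfl
      map_smul' := fun _ _ => rfl } B fun f => HInf.norm_le (key f)

theorem isCompInf_compCLM {v w : Weight} (φ : 𝔻 → 𝔻) (hφ : IsHolomorphic fun z => (φ z : ℂ))
    (B : ℝ) (hB : ∀ z, w z / v (φ z) ≤ B) : IsCompInf φ (compCLM φ hφ B hB) :=
  fun _ _ => rfl

theorem isCompact_range_of_ultrafilter {X Y : Type*} [TopologicalSpace Y] {f : X → Y}
    (h : ∀ U : Ultrafilter X, ∃ x, Tendsto f U (𝓝 (f x))) : IsCompact (Set.range f) := by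
  rw [isCompact_iff_ultrafilter_le_nhds]
  intro V hV
  have hne : (comap f (V : Filter Y)).NeBot := by
    refine comap_neBot fun t ht => ?_
    obtain ⟨_, hy, x, rfl⟩ := V.nonempty_of_mem (inter_mem ht (le_principal_iff.1 hV))
    exact ⟨x, hy⟩
  obtain ⟨x, hx⟩ := h (Ultrafilter.of (comap f V))
  refine ⟨f x, ⟨x, rfl⟩, ?_⟩
  have hle : ((Ultrafilter.of (comap f V)).map f : Filter Y) ≤ V :=
    (map_mono (Ultrafilter.of_le _)).trans map_comap_le
  rwa [← Ultrafilter.coe_le_coe.1 hle]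

/-- Every ultrafilter on the closed unit ball of `H_v^∞` converges locally uniformly. -/
theorem exists_tendstoLocallyUniformly {v : Weight} (U : Ultrafilter {f : HInf v // ‖f‖ ≤ 1}) :
    ∃ g : {f : HInf v // ‖f‖ ≤ 1},
      TendstoLocallyUniformly (fun (f : {f : HInf v // ‖f‖ ≤ 1}) => (f.1 : 𝔻 → ℂ)) g.1 U := by
  have hb : ∀ (f : {f : HInf v // ‖f‖ ≤ 1}) z, ‖f.1 z‖ * v z ≤ 1 :=
    fun f z => (f.1.le_norm z).trans f.2
  have hlim : ∀ z, ∃ c, Tendsto (fun f : {f : HInf v // ‖f‖ ≤ 1} => f.1 z) U (𝓝 c) := fun z => by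
    obtain ⟨c, -, hc⟩ := (isCompact_closedBall (0 : ℂ) (1 / v z)).ultrafilter_le_nhds
      (U.map fun f => f.1 z) (by
        rw [le_principal_iff, Ultrafilter.mem_coe, Ultrafilter.mem_map]
        refine univ_mem' fun f => ?_
        simpa [le_div_iff₀ (v.pos z)] using (f.1.norm_apply_le z).trans
          (div_le_div_of_nonneg_right f.2 (v.pos z).le))
    exact ⟨c, hc⟩
  choose g hg using hlim
  have hlu := tendstoLocallyUniformly_of_tendsto (fun f => f.1.isHolomorphic) hb hg
  have hgb : ∀ z, ‖g z‖ * v z ≤ 1 := fun z =>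
    le_of_tendsto ((hg z).norm.mul_const (v z)) (.of_forall fun f => hb f z)
  let G : HInf v := ⟨g, IsHolomorphic.of_tendstoLocallyUniformly (fun f => f.1.isHolomorphic) hlu,
    1, by rintro _ ⟨z, rfl⟩; exact hgb z⟩
  exact ⟨⟨G, HInf.norm_le hgb⟩, hlu⟩

theorem isCompactOperator_of_tendsto {v w : Weight} {φ : 𝔻 → 𝔻} (hφ : Continuous φ)
    (h : Tendsto (fun z => w z / v (φ z)) toBoundary (𝓝 0)) {T : HInf v →L[ℂ] HInf w}
    (hT : IsCompInf φ T) : IsCompactOperator T := by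
  refine (isCompactOperator_iff_image_closedBall_subset_compact (𝕜₁ := ℂ) (T : HInf v →ₗ[ℂ] HInf w)
    one_pos).2 ⟨Set.range fun f : {f : HInf v // ‖f‖ ≤ 1} => T f.1, ?_, ?_⟩
  · refine isCompact_range_of_ultrafilter fun U => ?_
    obtain ⟨g, hg⟩ := exists_tendstoLocallyUniformly U
    refine ⟨g, ?_⟩
    rw [Metric.tendsto_nhds]
    intro ε hε
    obtain ⟨R, hR, hRz⟩ :=
      eventually_toBoundary.1 (h.eventually (gt_mem_nhds (show 0 < ε / 4 by linarith)))
    obtain ⟨M, hM, hMz⟩ := exists_upper_bound w.continuous hR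
    have hK := (isCompact_norm_le hR).image hφ
    have hu := (tendstoLocallyUniformlyOn_iff_tendstoUniformlyOn_of_compact hK).1
      (hg.tendstoLocallyUniformlyOn (s := φ '' {z : 𝔻 | ‖(z : ℂ)‖ ≤ R}))
    rw [Metric.tendstoUniformlyOn_iff] at hu
    filter_upwards [hu (ε / (2 * M)) (by positivity)] with f hf
    rw [dist_eq_norm, ← map_sub]
    refine (HInf.norm_le (A := ε / 2) fun z => ?_).trans_lt (by linarith)
    rw [hT]
    rcases le_or_gt ‖(z : ℂ)‖ R with hz | hz
    · have h1 := (hf (φ z) ⟨z, hz, rfl⟩).le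
      rw [dist_comm, dist_eq_norm] at h1
      calc ‖(f.1 - g.1) (φ z)‖ * w z ≤ ε / (2 * M) * M :=
            mul_le_mul h1 (hMz z hz) (w.pos z).le (by positivity)
        _ = ε / 2 := by field_simp
    · refine (norm_comp_mul_le w φ (f.1 - g.1) z).trans ?_
      have h1 : ‖f.1 - g.1‖ ≤ 2 := (norm_sub_le _ _).trans (by linarith [f.2, g.2])
      calc ‖f.1 - g.1‖ * (w z / v (φ z)) ≤ 2 * (ε / 4) :=
            mul_le_mul h1 (hRz z hz).le (div_pos (w.pos _) (v.pos _)).le (by norm_num)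
        _ = ε / 2 := by ring
  · rintro _ ⟨f, hf, rfl⟩
    exact ⟨⟨f, by simpa using hf⟩, rfl⟩

theorem memHZero_comp_of_tendsto {v w : Weight} {φ : 𝔻 → 𝔻}
    (hφ : IsHolomorphic fun z => (φ z : ℂ))
    (h : Tendsto (fun z => w z / v (φ z)) toBoundary (𝓝 0)) (f : HInf v) :
    MemHZero w (f ∘ φ) := by
  refine ⟨f.isHolomorphic.comp hφ, squeeze_zero
    (fun z => mul_nonneg (norm_nonneg _) (w.pos z).le) (norm_comp_mul_le w φ f) ?_⟩
  simpa using h.const_mul ‖f‖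

theorem exists_compact_of_tendsto {v w : Weight} {φ : 𝔻 → 𝔻}
    (hφ : IsHolomorphic fun z => (φ z : ℂ))
    (h : Tendsto (fun z => w z / v (φ z)) toBoundary (𝓝 0)) :
    ∃ T : HInf v →L[ℂ] HInf w, IsCompInf φ T ∧ IsCompactOperator T := by
  have hc := hφ.continuous_map
  obtain ⟨B, -, hB⟩ := bounded_of_tendsto_toBoundary
    (w.continuous.div (v.continuous.comp hc) fun z => (v.pos _).ne') h
  exact ⟨_, isCompInf_compCLM φ hφ B hB, isCompactOperator_of_tendsto hc h
    (isCompInf_compCLM φ hφ B hB)⟩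

theorem exists_compact_HZero_of_tendsto {v w : Weight} {φ : 𝔻 → 𝔻}
    (hφ : IsHolomorphic fun z => (φ z : ℂ))
    (h : Tendsto (fun z => w z / v (φ z)) toBoundary (𝓝 0)) :
    ∃ T : HZero v →L[ℂ] HZero w, IsCompZero φ T ∧ IsCompactOperator T := by
  obtain ⟨T, hT, hTc⟩ := exists_compact_of_tendsto hφ h
  have hmem : ∀ f : HZero v, (T ∘L (HZero v).subtypeL) f ∈ HZero w := fun f => by
    rw [mem_HZero]
    exact (memHZero_comp_of_tendsto hφ h f.1).2.congr fun z => by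
      simp [hT f.1 z]
  exact ⟨(T ∘L (HZero v).subtypeL).codRestrict (HZero w) hmem, fun f z => hT f.1 z,
    (hTc.comp_clm (HZero v).subtypeL).codRestrict hmem (isClosed_HZero w)⟩

theorem IsWeaklyCompactOperator.of_isCompactOperator {E F : Type*} [NormedAddCommGroup E]
    [NormedSpace ℂ E] [NormedAddCommGroup F] [NormedSpace ℂ F] {T : E →L[ℂ] F}
    (hT : IsCompactOperator T) : IsWeaklyCompactOperator T := by
  obtain ⟨K, hK, hTK⟩ := IsCompactOperator.image_closedBall_subset_compact (𝕜₁ := ℂ)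
    (f := (T : E →ₗ[ℂ] F)) hT 1
  refine (hK.image (toWeakSpaceCLM ℂ F).continuous).closure_of_subset ?_
  rintro _ ⟨x, hx, rfl⟩
  exact ⟨T x, hTK ⟨x, hx, rfl⟩, rfl⟩

/-- Along a sequence in the unit ball, a weakly compact operator has a point whose functionals agree
with all existing limits of functionals along the image sequence. -/
theorem IsWeaklyCompactOperator.exists_weak_limit {E F : Type*} [NormedAddCommGroup E]
    [NormedSpace ℂ E] [NormedAddCommGroup F] [NormedSpace ℂ F] {T : E →L[ℂ] F}
    (hT : IsWeaklyCompactOperator T) {x : ℕ → E} (hx : ∀ n, ‖x n‖ ≤ 1) :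
    ∃ y : F, ∀ (ℓ : F →L[ℂ] ℂ) (c : ℂ), Tendsto (fun n => ℓ (T (x n))) atTop (𝓝 c) → ℓ y = c := by
  obtain ⟨y, -, hy⟩ := hT.ultrafilter_le_nhds
    ((hyperfilter ℕ).map fun n => toWeakSpace ℂ F (T (x n))) (by
      rw [le_principal_iff, Ultrafilter.mem_coe, Ultrafilter.mem_map]
      exact univ_mem' fun n => subset_closure ⟨x n, by simpa using hx n, rfl⟩)
  refine ⟨(toWeakSpace ℂ F).symm y, fun ℓ c hc => ?_⟩
  have h1 : Tendsto (fun n => ℓ (T (x n))) (hyperfilter ℕ) (𝓝 (ℓ ((toWeakSpace ℂ F).symm y))) :=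
    ((WeakBilin.eval_continuous (topDualPairing ℂ F).flip ℓ).tendsto y).comp hy
  exact tendsto_nhds_unique h1 (hc.mono_left Nat.hyperfilter_le_atTop)

theorem exists_functional_ne_zero {F : Type*} [NormedAddCommGroup F] [NormedSpace ℂ F]
    {V : Submodule ℂ F} (hV : IsClosed (V : Set F)) {y : F} (hy : y ∉ V) :
    ∃ ℓ : F →L[ℂ] ℂ, (∀ x ∈ V, ℓ x = 0) ∧ ℓ y ≠ 0 := by
  have : IsClosed (V : Set F) := hV
  have hne : V.mkQL y ≠ 0 := by simpa using hy
  obtain ⟨ℓ, hℓ⟩ := SeparatingDual.exists_ne_zero (R := ℂ) hne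
  exact ⟨ℓ ∘L V.mkQL, fun x hx => by simp [(Submodule.Quotient.mk_eq_zero V).2 hx], hℓ⟩

/-- The dilation `z ↦ r z` of the disc. -/
def dilation (r : ℝ) (h0 : 0 ≤ r) (h1 : r < 1) (z : 𝔻) : 𝔻 :=
  .mk (r * z) (by
    rw [norm_mul, norm_real, Real.norm_of_nonneg h0]
    nlinarith [z.norm_lt_one, norm_nonneg (z : ℂ)])

theorem isHolomorphic_dilation {r : ℝ} (h0 : 0 ≤ r) (h1 : r < 1) :
    IsHolomorphic fun z => (dilation r h0 h1 z : ℂ) :=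
  ⟨fun z => r * z, by fun_prop, fun z => rfl⟩

theorem norm_dilation {r : ℝ} (h0 : 0 ≤ r) (h1 : r < 1) (z : 𝔻) :
    ‖(dilation r h0 h1 z : ℂ)‖ = r * ‖(z : ℂ)‖ := by
  simp [dilation, abs_of_nonneg h0]

/-- By the maximum principle, dilations do not increase a radially weighted sup norm. -/
theorem norm_comp_dilation_mul_le {v : Weight} (f : HInf v) {r : ℝ} (h0 : 0 ≤ r) (h1 : r < 1)
    (z : 𝔻) : ‖f (dilation r h0 h1 z)‖ * v z ≤ ‖f‖ := by
  rcases eq_or_ne z 0 with rfl | hz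
  · have h : dilation r h0 h1 0 = 0 := by
      rw [← UnitDisc.coe_inj]; simp [dilation]
    rw [h]
    exact f.le_norm 0
  have hz0 : 0 < ‖(z : ℂ)‖ := by simpa using hz
  rw [← le_div_iff₀ (v.pos z)]
  obtain ⟨F, hF, hFf⟩ := f.isHolomorphic
  have hd : DiffContOnCl ℂ F (Metric.ball 0 ‖(z : ℂ)‖) := by
    refine DifferentiableOn.diffContOnCl (hF.mono ?_)
    rw [closure_ball _ hz0.ne']
    exact Metric.closedBall_subset_ball z.norm_lt_one
  rw [← hFf]
  refine norm_le_of_forall_mem_frontier_norm_le Metric.isBounded_ball hd (fun x hx => ?_)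
    (subset_closure ?_)
  · rw [frontier_ball _ hz0.ne', mem_sphere_zero_iff_norm] at hx
    lift x to 𝔻 using hx ▸ z.norm_lt_one
    rw [hFf, ← v.radial x z hx]
    exact f.norm_apply_le x
  · rw [mem_ball_zero_iff, norm_dilation]
    nlinarith

theorem exists_bounded_of_lt {v : Weight} (f : HInf v) (a : 𝔻) {c : ℝ} (hc : c < ‖f a‖ * v a) :
    ∃ g : HInf v, ‖g‖ ≤ ‖f‖ ∧ (∃ M, ∀ z, ‖g z‖ ≤ M) ∧ c < ‖g a‖ * v a := by
  obtain ⟨F, hF, hFf⟩ := f.isHolomorphic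
  have hlim : Tendsto (fun r : ℝ => ‖F (r * a)‖ * v a) (𝓝[<] 1) (𝓝 (‖f a‖ * v a)) := by
    have h1 : ContinuousAt F a :=
      (hF.differentiableAt (Metric.isOpen_ball.mem_nhds (by simpa using a.norm_lt_one))).continuousAt
    have h2 : Tendsto (fun r : ℝ => (r * a : ℂ)) (𝓝[<] 1) (𝓝 a) := by
      have : Continuous fun r : ℝ => (r * a : ℂ) := by fun_prop
      simpa using (this.tendsto 1).mono_left nhdsWithin_le_nhds
    rw [← hFf]
    exact (h1.tendsto.comp h2).norm.mul_const _
  obtain ⟨r, hr, hr0, hr1⟩ := ((hlim.eventually (lt_mem_nhds hc)).and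
    (Ioo_mem_nhdsLT (zero_lt_one' ℝ))).exists
  obtain ⟨m, hm, hmv⟩ := v.exists_lower_bound hr1
  have hb := norm_comp_dilation_mul_le f hr0.le hr1
  refine ⟨⟨fun z => f (dilation r hr0.le hr1 z),
    f.isHolomorphic.comp (isHolomorphic_dilation hr0.le hr1), ‖f‖, ?_⟩, HInf.norm_le hb,
    ⟨‖f‖ / m, fun z => ?_⟩, ?_⟩
  · rintro _ ⟨z, rfl⟩
    exact hb z
  · refine (f.norm_apply_le _).trans ?_
    refine div_le_div_of_nonneg_left (norm_nonneg _) hm (hmv _ ?_)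
    rw [norm_dilation]
    nlinarith [z.norm_lt_one]
  · change c < ‖f (dilation r hr0.le hr1 a)‖ * v a
    rwa [← hFf]

theorem Weight.IsEssential.exists_lt {v : Weight} (hv : v.IsEssential) :
    ∃ c > 0, ∀ a, ∃ f : HInf v, ‖f‖ ≤ 1 ∧ c < ‖f a‖ * v a := by
  obtain ⟨c, C, hc, hC, h⟩ := hv
  refine ⟨1 / (2 * C), by positivity, fun a => ?_⟩
  obtain ⟨h1, h2⟩ := h a
  have hva := v.pos a
  set S := ⨆ f : {f : HInf v // ‖f‖ ≤ 1}, ‖f.1 a‖ with hS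
  have hass : assocWeight v a = 1 / S := rfl
  have hS0 : 0 < S := by
    have : 0 < 1 / S := hass ▸ (mul_pos hc hva).trans_le h1
    simpa using this
  rw [hass, div_le_iff₀ hS0] at h2
  have h3 : 1 / (2 * C) / v a < S := by
    rw [div_div, div_lt_iff₀ (by positivity)]
    nlinarith
  have : Nonempty {f : HInf v // ‖f‖ ≤ 1} := ⟨⟨0, by simp⟩⟩
  obtain ⟨f, hf⟩ := exists_lt_of_lt_ciSup h3
  exact ⟨f.1, f.2, (div_lt_iff₀ hva).1 hf⟩

/-- Bounded functions that are small inside the disc and attain the extremal growth at a point. -/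
theorem Weight.IsEssential.exists_peak {v : Weight} (hv : v.IsEssential) :
    ∃ c > 0, ∀ (n : ℕ) (a : 𝔻), ∃ g : HInf v, (∃ M, ∀ z, ‖g z‖ ≤ M) ∧
      (∀ z, ‖g z‖ * v z ≤ ‖(z : ℂ)‖ ^ n) ∧ c * ‖(a : ℂ)‖ ^ n ≤ ‖g a‖ * v a := by
  obtain ⟨c, hc, h⟩ := hv.exists_lt
  refine ⟨c, hc, fun n a => ?_⟩
  obtain ⟨f₀, hf₀, hf₀a⟩ := h a
  obtain ⟨f, hf, ⟨M, hM⟩, hfa⟩ := exists_bounded_of_lt f₀ a hf₀a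
  have hle : ∀ z : 𝔻, ‖(z : ℂ) ^ n‖ ≤ 1 := fun z => by
    rw [norm_pow]
    exact pow_le_one₀ (norm_nonneg _) z.norm_lt_one.le
  have hb : ∀ z : 𝔻, ‖(z : ℂ) ^ n * f z‖ * v z ≤ ‖(z : ℂ)‖ ^ n := fun z => by
    rw [norm_mul, norm_pow, mul_assoc]
    exact mul_le_of_le_one_right (by positivity) ((f.le_norm z).trans (hf.trans hf₀))
  refine ⟨⟨fun z => (z : ℂ) ^ n * f z,
    IsHolomorphic.mul ⟨fun z => z ^ n, by fun_prop, fun _ => rfl⟩ f.isHolomorphic, 1, ?_⟩,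
    ⟨M, fun z => ?_⟩, hb, ?_⟩
  · rintro _ ⟨z, rfl⟩
    exact (hb z).trans ((norm_pow (z : ℂ) n).symm.trans_le (hle z))
  · change ‖(z : ℂ) ^ n * f z‖ ≤ M
    rw [norm_mul]
    exact (mul_le_of_le_one_left (norm_nonneg _) (hle z)).trans (hM z)
  · change _ ≤ ‖(a : ℂ) ^ n * f a‖ * v a
    rw [norm_mul, norm_pow, mul_assoc, mul_comm c]
    gcongr

theorem exists_of_not_tendsto {v w : Weight} {φ : 𝔻 → 𝔻}
    (h : ¬ Tendsto (fun z => w z / v (φ z)) toBoundary (𝓝 0)) :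
    ∃ ε > 0, ∀ R < 1, ∃ z : 𝔻, R < ‖(z : ℂ)‖ ∧ R < ‖(φ z : ℂ)‖ ∧ ε ≤ w z / v (φ z) := by
  rw [Metric.tendsto_nhds] at h
  push Not at h
  obtain ⟨ε, hε, hf⟩ := h
  refine ⟨ε, hε, fun R hR => ?_⟩
  obtain ⟨m, hm, hmv⟩ := v.exists_lower_bound hR
  have hw := w.vanishes.eventually (gt_mem_nhds (mul_pos hε hm))
  have hR' : ∀ᶠ z : 𝔻 in toBoundary, R < ‖(z : ℂ)‖ := eventually_toBoundary.2 ⟨R, hR, fun _ h => h⟩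
  obtain ⟨z, hz, hzw, hzR⟩ := (hf.and_eventually (hw.and hR')).exists
  rw [Real.dist_eq, sub_zero, abs_of_nonneg (div_pos (w.pos _) (v.pos _)).le] at hz
  refine ⟨z, hzR, ?_, hz⟩
  by_contra! hφ
  rw [le_div_iff₀ (v.pos _)] at hz
  have := mul_le_mul_of_nonneg_left (hmv _ hφ) hε.le
  linarith

/-- One hump: a bounded function whose weighted modulus is at most `1`, is at least `c` at `φ z`,
and is at most `δ` off the annulus `R < |x| < R'`. -/
theorem exists_hump {v w : Weight} {φ : 𝔻 → 𝔻} (hv : v.IsEssential)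
    (h : ¬ Tendsto (fun z => w z / v (φ z)) toBoundary (𝓝 0)) :
    ∃ c > 0, ∃ ε > 0, ∀ δ > 0, ∀ η < 1, ∀ R < 1, ∃ (g : HInf v) (z : 𝔻) (R' : ℝ),
      R' < 1 ∧ R < ‖(φ z : ℂ)‖ ∧ ‖(φ z : ℂ)‖ < R' ∧ η < ‖(z : ℂ)‖ ∧ ε ≤ w z / v (φ z) ∧
      (∃ M, ∀ x, ‖g x‖ ≤ M) ∧ (∀ x, ‖g x‖ * v x ≤ 1) ∧ c ≤ ‖g (φ z)‖ * v (φ z) ∧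
      ∀ x : 𝔻, ‖(x : ℂ)‖ ≤ R ∨ R' ≤ ‖(x : ℂ)‖ → ‖g x‖ * v x ≤ δ := by
  obtain ⟨c, hc, hpeak⟩ := hv.exists_peak
  obtain ⟨ε, hε, hz⟩ := exists_of_not_tendsto h
  refine ⟨c / 2, by positivity, ε, hε, fun δ hδ η hη R hR => ?_⟩
  obtain ⟨n, hn⟩ := exists_pow_lt_of_lt_one hδ (max_lt hR zero_lt_one)
  obtain ⟨ρ, hρ1, hρ⟩ : ∃ ρ < 1, ∀ t, ρ < t → t < 1 → (1 : ℝ) / 2 ≤ t ^ n := by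
    have hlim : Tendsto (fun t : ℝ => t ^ n) (𝓝[<] 1) (𝓝 1) := by
      simpa using ((continuous_pow n).tendsto (1 : ℝ)).mono_left nhdsWithin_le_nhds
    obtain ⟨ρ, hρ, hρt⟩ := (nhdsLT_basis (1 : ℝ)).eventually_iff.1
      (hlim.eventually (lt_mem_nhds (show (1 : ℝ) / 2 < 1 by norm_num)))
    exact ⟨ρ, hρ, fun t h1 h2 => (hρt ⟨h1, h2⟩).le⟩
  obtain ⟨z, hz1, hz2, hzε⟩ := hz (max (max R η) ρ) (by simp [*])
  simp only [max_lt_iff] at hz1 hz2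
  obtain ⟨g, ⟨M, hM⟩, hgn, hgc⟩ := hpeak n (φ z)
  obtain ⟨r, hr1, hr⟩ := eventually_toBoundary.1
    ((memHZero_of_bounded (w := v) g.isHolomorphic hM).2.eventually (gt_mem_nhds hδ))
  obtain ⟨R', hR', hR'1⟩ := exists_between (max_lt hr1 (φ z).norm_lt_one)
  rw [max_lt_iff] at hR'
  refine ⟨g, z, R', hR'1, hz2.1.1, hR'.2, hz1.1.2, hzε, ⟨M, hM⟩, fun x => (hgn x).trans
    (pow_le_one₀ (norm_nonneg _) x.norm_lt_one.le), le_trans ?_ hgc, ?_⟩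
  · have := mul_le_mul_of_nonneg_left (hρ _ hz2.2 (φ z).norm_lt_one) hc.le
    linarith
  · rintro x (hx | hx)
    · exact (hgn x).trans ((pow_le_pow_left₀ (norm_nonneg _) (hx.trans (le_max_left R 0)) n).trans
        hn.le)
    · exact (hr x (hR'.1.trans_le hx)).le

theorem sum_le_of_disjoint_humps {R : ℕ → ℝ} (hR : Monotone R) {t : ℝ} {a δ : ℕ → ℝ}
    (ha : ∀ k, a k ≤ 1) (hδ : ∀ k, 0 ≤ δ k)
    (haδ : ∀ k, t ≤ R k ∨ R (k + 1) ≤ t → a k ≤ δ k) (s : Finset ℕ) :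
    ∑ k ∈ s, a k ≤ 1 + ∑ k ∈ s, δ k := by
  classical
  have h1 : ∀ k ∈ s, a k ≤ (if R k < t ∧ t < R (k + 1) then 1 else 0) + δ k := fun k _ => by
    split_ifs with h
    · linarith [ha k, hδ k]
    · rw [zero_add]
      refine haδ k ?_
      by_contra! h'
      exact h h'
  refine (Finset.sum_le_sum h1).trans ?_
  rw [Finset.sum_add_distrib, Finset.sum_boole]
  gcongr
  norm_cast
  refine Finset.card_le_one.2 fun i hi j hj => ?_
  simp only [Finset.mem_filter] at hi hj
  rcases lt_trichotomy i j with hij | hij | hij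
  · have := hR (Nat.succ_le_of_lt hij)
    simp only [Nat.succ_eq_add_one] at this
    linarith
  · exact hij
  · have := hR (Nat.succ_le_of_lt hij)
    simp only [Nat.succ_eq_add_one] at this
    linarith

theorem HInf.sum_apply {v : Weight} {ι : Type*} (s : Finset ι) (g : ι → HInf v) (z : 𝔻) :
    (∑ k ∈ s, g k) z = ∑ k ∈ s, g k z :=
  map_sum (HInf.evalCLM z) g s

theorem exists_gliding_hump {v w : Weight} {φ : 𝔻 → 𝔻} (hv : v.IsEssential)
    (h : ¬ Tendsto (fun z => w z / v (φ z)) toBoundary (𝓝 0)) :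
    ∃ (s : ℕ → HInf v) (f : HInf v), (∀ N, ‖s N‖ ≤ 1) ∧ (∀ N, ∃ M, ∀ z, ‖s N z‖ ≤ M) ∧
      (∀ z, Tendsto (fun N => s N z) atTop (𝓝 (f z))) ∧ ¬ MemHZero w (f ∘ φ) := by
  obtain ⟨c, hc, ε, hε, hump⟩ := exists_hump hv h
  let δ : ℕ → ℝ := fun k => c / 4 * (1 / 2) ^ k
  have hδ0 : ∀ k, 0 < δ k := fun k => by positivity
  have hδs : ∀ s : Finset ℕ, ∑ k ∈ s, δ k ≤ c / 2 := fun s => by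
    rw [← Finset.mul_sum]
    have := summable_geometric_two.sum_le_tsum s (fun _ _ => by positivity)
    rw [tsum_geometric_two] at this
    nlinarith
  have hη : ∀ k : ℕ, 1 - 1 / ((k : ℝ) + 1) < 1 := fun k => by
    have : 0 < 1 / ((k : ℝ) + 1) := by positivity
    linarith
  choose g z R' hR' hRz hzR' hz hεz hgM hg1 hgc hgδ using
    fun (k : ℕ) (R : {R : ℝ // R < 1}) => hump (δ k) (hδ0 k) _ (hη k) R.1 R.2
  let R : ℕ → {R : ℝ // R < 1} := fun k => Nat.rec ⟨0, one_pos⟩ (fun k R => ⟨R' k R, hR' k R⟩) k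
  have hRs : ∀ k, (R (k + 1)).1 = R' k (R k) := fun k => rfl
  have hRmono : Monotone fun k => (R k).1 := monotone_nat_of_le_succ fun k => by
    rw [hRs]
    exact ((hRz k (R k)).trans (hzR' k (R k))).le
  let G : ℕ → HInf v := fun k => g k (R k)
  let a : ℕ → 𝔻 := fun k => φ (z k (R k))
  have hsum : ∀ (x : 𝔻) (s : Finset ℕ), ∑ k ∈ s, ‖G k x‖ * v x ≤ 1 + c / 2 := fun x s =>
    (sum_le_of_disjoint_humps hRmono (fun k => hg1 k (R k) x) (fun k => (hδ0 k).le)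
      (fun k hk => hgδ k (R k) x hk) s).trans (by linarith [hδs s])
  have hoff : ∀ j k, k ≠ j → ‖G k (a j)‖ * v (a j) ≤ δ k := fun j k hkj => by
    refine hgδ k (R k) (a j) ?_
    rcases lt_or_gt_of_ne hkj with hlt | hlt
    · exact Or.inr ((hRmono (Nat.succ_le_of_lt hlt)).trans (hRz j (R j)).le)
    · exact Or.inl ((hzR' j (R j)).le.trans (hRmono (Nat.succ_le_of_lt hlt)))
  let S : ℕ → HInf v := fun N => ∑ k ∈ Finset.range N, G k
  have hSb : ∀ N x, ‖S N x‖ * v x ≤ 1 + c / 2 := fun N x => by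
    refine le_trans ?_ (hsum x (Finset.range N))
    rw [HInf.sum_apply, ← Finset.sum_mul]
    exact mul_le_mul_of_nonneg_right (norm_sum_le _ _) (v.pos x).le
  have hlim : ∀ x, Tendsto (fun N => S N x) atTop (𝓝 (∑' k, G k x)) := fun x => by
    have hs : Summable fun k => ‖G k x‖ * v x := summable_of_sum_le
      (fun k => mul_nonneg (norm_nonneg _) (v.pos x).le) (hsum x)
    have hs' : Summable fun k => G k x :=
      .of_norm ((summable_mul_right_iff (v.pos x).ne').1 hs)
    simpa only [S, HInf.sum_apply] using hs'.hasSum.tendsto_sum_nat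
  have hlow : ∀ j, c / 2 ≤ ‖∑' k, G k (a j)‖ * v (a j) := fun j => by
    refine ge_of_tendsto ((hlim (a j)).norm.mul_const _) ?_
    filter_upwards [eventually_gt_atTop j] with N hN
    have hv0 := (v.pos (a j)).le
    have hsplit : S N (a j) = G j (a j) + ∑ k ∈ (Finset.range N).erase j, G k (a j) := by
      rw [HInf.sum_apply]
      exact (Finset.add_sum_erase _ (fun k => G k (a j)) (Finset.mem_range.2 hN)).symm
    have h1 : ‖∑ k ∈ (Finset.range N).erase j, G k (a j)‖ * v (a j) ≤ c / 2 :=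
      calc _ ≤ (∑ k ∈ (Finset.range N).erase j, ‖G k (a j)‖) * v (a j) :=
            mul_le_mul_of_nonneg_right (norm_sum_le _ _) hv0
        _ = ∑ k ∈ (Finset.range N).erase j, ‖G k (a j)‖ * v (a j) := Finset.sum_mul _ _ _
        _ ≤ ∑ k ∈ (Finset.range N).erase j, δ k :=
            Finset.sum_le_sum fun k hk => hoff j k (Finset.ne_of_mem_erase hk)
        _ ≤ c / 2 := hδs _
    have h2 : c ≤ ‖G j (a j)‖ * v (a j) := hgc j (R j)
    have h3 := mul_le_mul_of_nonneg_right
      (norm_sub_le_norm_add (G j (a j)) (∑ k ∈ (Finset.range N).erase j, G k (a j))) hv0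
    rw [hsplit]
    rw [sub_mul] at h3
    linarith
  have hlu := tendstoLocallyUniformly_of_tendsto (fun N => (S N).isHolomorphic) hSb hlim
  let f : HInf v := ⟨fun x => ∑' k, G k x,
    IsHolomorphic.of_tendstoLocallyUniformly (fun N => (S N).isHolomorphic) hlu, 1 + c / 2, by
      rintro _ ⟨x, rfl⟩
      exact le_of_tendsto ((hlim x).norm.mul_const _) (.of_forall fun N => hSb N x)⟩
  set K := 1 + c / 2 with hK
  have hK0 : 0 < K := by positivity
  have hKn : ‖((K⁻¹ : ℝ) : ℂ)‖ = K⁻¹ := by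
    rw [norm_real, Real.norm_of_nonneg (inv_nonneg.2 hK0.le)]
  refine ⟨fun N => ((K⁻¹ : ℝ) : ℂ) • S N, ((K⁻¹ : ℝ) : ℂ) • f, fun N => ?_, fun N => ?_,
    fun x => (hlim x).const_mul _, fun hmem => ?_⟩
  · rw [norm_smul, hKn, inv_mul_le_iff₀ hK0, mul_one]
    exact HInf.norm_le (hSb N)
  · choose M hM using fun k => hgM k (R k)
    refine ⟨K⁻¹ * ∑ k ∈ Finset.range N, M k, fun x => ?_⟩
    rw [HInf.smul_apply, norm_mul, hKn, HInf.sum_apply]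
    gcongr
    exact norm_sum_le_of_le _ fun k _ => hM k x
  · obtain ⟨r, hr, hrz⟩ := eventually_toBoundary.1
      (hmem.2.eventually (gt_mem_nhds (show 0 < K⁻¹ * (c / 2 * ε) by positivity)))
    obtain ⟨j, hj⟩ := exists_nat_one_div_lt (sub_pos.2 hr)
    have h1 := hrz (z j (R j)) ((by linarith : r < 1 - 1 / ((j : ℝ) + 1)).trans (hz j (R j)))
    rw [Function.comp_apply, HInf.smul_apply, norm_mul, hKn, mul_assoc] at h1
    have h2 := lt_of_mul_lt_mul_left h1 (inv_nonneg.2 hK0.le)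
    have h3 := hεz j (R j)
    rw [le_div_iff₀ (v.pos _)] at h3
    have h4 : c / 2 * ε ≤ ‖f (a j)‖ * v (a j) * ε := mul_le_mul_of_nonneg_right (hlow j) hε.le
    have h5 : ‖f (a j)‖ * (ε * v (a j)) ≤ ‖f (a j)‖ * w (z j (R j)) :=
      mul_le_mul_of_nonneg_left h3 (norm_nonneg _)
    have h6 : ‖f (a j)‖ * w (z j (R j)) < c / 2 * ε := h2
    linarith

theorem tendsto_of_forall_memHZero {v w : Weight} {φ : 𝔻 → 𝔻} (hv : v.IsEssential)
    (h : ∀ f : 𝔻 → ℂ, MemHInf v f → MemHZero w (f ∘ φ)) :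
    Tendsto (fun z => w z / v (φ z)) toBoundary (𝓝 0) := by
  by_contra hn
  obtain ⟨-, f, -, -, -, hf⟩ := exists_gliding_hump hv hn
  exact hf (h f f.2)

theorem tendsto_of_isWeaklyCompactOperator {v w : Weight} {φ : 𝔻 → 𝔻} (hv : v.IsEssential)
    {T : HInf v →L[ℂ] HInf w} (hT : IsCompInf φ T) (hTc : IsWeaklyCompactOperator T) :
    Tendsto (fun z => w z / v (φ z)) toBoundary (𝓝 0) := by
  by_contra hn
  obtain ⟨s, f, hs, hsb, hlim, hf⟩ := exists_gliding_hump hv hn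
  obtain ⟨y, hy⟩ := hTc.exists_weak_limit hs
  have hyf : (y : 𝔻 → ℂ) = f ∘ φ := funext fun z =>
    hy (HInf.evalCLM z) _ ((hlim (φ z)).congr fun N => (hT (s N) z).symm)
  have hmem : ∀ N, T (s N) ∈ HZero w := fun N => by
    obtain ⟨M, hM⟩ := hsb N
    exact memHZero_of_bounded (T (s N)).isHolomorphic fun z => by
      rw [hT]
      exact hM _
  have hy0 : y ∈ HZero w := by
    by_contra hyn
    obtain ⟨ℓ, hℓ, hℓy⟩ := exists_functional_ne_zero (isClosed_HZero w) hyn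
    exact hℓy (hy ℓ 0 (tendsto_const_nhds.congr fun N => (hℓ _ (hmem N)).symm))
  have hy1 : MemHZero w y := hy0
  exact hf (hyf ▸ hy1)

theorem tendsto_of_isWeaklyCompactOperator_HZero {v w : Weight} {φ : 𝔻 → 𝔻}
    (hv : v.IsEssential) {T : HZero v →L[ℂ] HZero w} (hT : IsCompZero φ T)
    (hTc : IsWeaklyCompactOperator T) : Tendsto (fun z => w z / v (φ z)) toBoundary (𝓝 0) := by
  by_contra hn
  obtain ⟨s, f, hs, hsb, hlim, hf⟩ := exists_gliding_hump hv hn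
  have hs0 : ∀ N, s N ∈ HZero v := fun N => by
    obtain ⟨M, hM⟩ := hsb N
    exact memHZero_of_bounded (s N).isHolomorphic hM
  obtain ⟨y, hy⟩ := hTc.exists_weak_limit (x := fun N => ⟨s N, hs0 N⟩) hs
  have hyf : (y.1 : 𝔻 → ℂ) = f ∘ φ := funext fun z =>
    hy (HInf.evalCLM z ∘L (HZero w).subtypeL) _
      ((hlim (φ z)).congr fun N => (hT ⟨s N, hs0 N⟩ z).symm)
  have hy1 : MemHZero w y.1 := y.2
  exact hf (hyf ▸ hy1)

end WeightedHol

end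

open WeightedHol in
/-- Compactness of a composition operator includes that it is a well-defined bounded operator
between the spaces in question. The supremum in the third item is taken in `[0, ∞]`. -/
theorem mainTheorem4 (v w : Weight) (hv : v.IsEssential) (hw : w.IsEssential)
    (φ : 𝔻 → 𝔻) (hφ : IsHolomorphic (fun z => (φ z : ℂ))) :
    List.TFAE [
      ∃ T : HInf v →L[ℂ] HInf w, IsCompInf φ T ∧ IsCompactOperator T,
      ∃ T : HZero v →L[ℂ] HZero w, IsCompZero φ T ∧ IsCompactOperator T,
      Tendsto (fun r : ℝ => ⨆ (z : 𝔻) (_ : r < ‖(φ z : ℂ)‖), ENNReal.ofReal (w z / v (φ z)))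
          (𝓝[<] 1) (𝓝 0) ∨
        closure (Set.range fun z => (φ z : ℂ)) ⊆ Metric.ball 0 1,
      Tendsto (fun z => w z / v (φ z)) toBoundary (𝓝 0),
      ∃ T : HInf v →L[ℂ] HInf w, IsCompInf φ T ∧ IsWeaklyCompactOperator T,
      ∃ T : HZero v →L[ℂ] HZero w, IsCompZero φ T ∧ IsWeaklyCompactOperator T,
      ∀ f : 𝔻 → ℂ, MemHInf v f → MemHZero w (f ∘ φ)] := by
  have hc := hφ.continuous_map
  tfae_have 3 → 4 := fun h => (tendsto_iSup_iff_tendsto_toBoundary v w hc).1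
    (h.elim id (tendsto_iSup_of_closure_subset v w))
  tfae_have 4 → 3 := fun h => Or.inl ((tendsto_iSup_iff_tendsto_toBoundary v w hc).2 h)
  tfae_have 4 → 1 := exists_compact_of_tendsto hφ
  tfae_have 4 → 2 := exists_compact_HZero_of_tendsto hφ
  tfae_have 4 → 7 := fun h f hf => memHZero_comp_of_tendsto hφ h ⟨f, hf⟩
  tfae_have 1 → 5 := fun ⟨T, hT, hTc⟩ => ⟨T, hT, .of_isCompactOperator hTc⟩
  tfae_have 2 → 6 := fun ⟨T, hT, hTc⟩ => ⟨T, hT, .of_isCompactOperator hTc⟩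
  tfae_have 5 → 4 := fun ⟨_, hT, hTc⟩ => tendsto_of_isWeaklyCompactOperator hv hT hTc
  tfae_have 6 → 4 := fun ⟨_, hT, hTc⟩ => tendsto_of_isWeaklyCompactOperator_HZero hv hT hTc
  tfae_have 7 → 4 := tendsto_of_forall_memHZero hv
  tfae_finish
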